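/- Let $X=[a,b]$ be a compact interval ($a\le b$) or $X=\mathbb R$, let $k\in\mathbb N$, and let $L^2(X,\mathbb C^k)$ be taken with respect to Lebesgue measure, with inner product $\langle\phi,\psi\rangle=\int_X\phi(x)^*\psi(x)\,dx$. Let $\mathcal K$ be a trace class operator on $L^2(X,\mathbb C^k)$, that is, a compact operator whose singular values (the square roots of the eigenvalues of $\mathcal K^*\mathcal K$, counted with multiplicity) have a finite sum. Suppose that for every $\phi\in L^2(X,\mathbb C^k)$ $$(\mathcal K\phi)(x)=\int_X \mathsf K(x,y)\,\phi(y)\,dy\qquad\text{for almost every }x\in X,$$ where the matrix-valued kernel $\mathsf K:X\times X\to\mathbb C^{k\times k}$ is continuous and square-integrable on $X\times X$, and suppose that the function $x\mapsto\operatorname{Tr}(\mathsf K(x,x))$ is integrable on $X$. Then $$\operatorname{Tr}(\mathcal K)=\int_X\operatorname{Tr}(\mathsf K(x,x))\,dx .$$ Here $\operatorname{Tr}(\mathcal K)=\sum_i\langle h_i,\mathcal K h_i\rangle$ for any orthonormal basis $(h_i)$ of $L^2(X,\mathbb C^k)$; part of the claim is that this series converges unconditionally for every orthonormal basis, with the same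 sum. -/

import Mathlib

open MeasureTheory
open scoped NNReal ENNReal

noncomputable section

namespace TraceFormula

universe u

section Abstract

variable {H : Type u} [NormedAddCommGroup H] [InnerProductSpace ℂ H] [CompleteSpace H]

/-- The multiplicity of `μ` as a singular value of the operator `T`, that is, the dimension of the
eigenspace of `T* T` for the eigenvalue `μ ^ 2`. (For `T` compact and `μ ≠ 0` this space is
finite dimensional.) -/
def singularMultiplicity (T : H →L[ℂ] H) (μ : ℝ≥0) : ℕ :=
  Module.finrank ℂ
    (Module.End.eigenspace ((ContinuousLinearMap.adjoint T ∘L T : H →L[ℂ] H) : H →ₗ[ℂ] H) (((μ : ℝ) : ℂ) ^ 2))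

/-- The Schatten `1`-norm of a compact operator `T`: the sum of its singular values, each repeated
according to its multiplicity, as an element of `[0, ∞]`. -/
def traceNorm (T : H →L[ℂ] H) : ℝ≥0∞ :=
  ∑' μ : ℝ≥0, (singularMultiplicity T μ : ℝ≥0∞) * (μ : ℝ≥0∞)

/-- Trace class operators: compact operators whose singular values have a finite sum. -/
def IsTraceClass (T : H →L[ℂ] H) : Prop :=
  IsCompactOperator T ∧ traceNorm T < ∞

/-- `T` has trace `t`: for every orthonormal basis `h` of the Hilbert space, the series
`∑ ⟪h i, T (h i)⟫` converges (unconditionally) to `t`. -/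
def HasTrace (T : H →L[ℂ] H) (t : ℂ) : Prop :=
  ∀ ⦃ι : Type u⦄ (h : HilbertBasis ι ℂ H), HasSum (fun i => inner ℂ (h i) (T (h i))) t

/-- An orthonormal basis of the Hilbert space. -/
def someBasis (H : Type u) [NormedAddCommGroup H] [InnerProductSpace ℂ H] [CompleteSpace H] :
    HilbertBasis (exists_hilbertBasis ℂ H).choose ℂ H :=
  (exists_hilbertBasis ℂ H).choose_spec.choose

/-- The trace `Tr T = ∑ ⟪h i, T (h i)⟫`, computed in some orthonormal basis `h`; see `HasTrace` for
the independence of the basis. -/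
def trace (T : H →L[ℂ] H) : ℂ :=
  ∑' i, inner ℂ (someBasis H i) (T (someBasis H i))

theorem HasTrace.trace_eq {T : H →L[ℂ] H} {t : ℂ} (ht : HasTrace T t) : trace T = t :=
  (ht (someBasis H)).tsum_eq

end Abstract

/-- The Hilbert space `L²(X, ℂ^k)` of (classes of) square-integrable functions on `X ⊆ ℝ`, with
respect to Lebesgue measure on `X`. -/
abbrev L2 (X : Set ℝ) (k : ℕ) : Type :=
  Lp (EuclideanSpace ℂ (Fin k)) 2 ((volume : Measure ℝ).restrict X)

/-- The matrix-valued kernel `K` on `X × X` is square-integrable. -/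
def IsL2Kernel (X : Set ℝ) {k : ℕ} (K : ℝ → ℝ → Matrix (Fin k) (Fin k) ℂ) : Prop :=
  ∀ i j : Fin k, MemLp (fun p : ℝ × ℝ => K p.1 p.2 i j) 2
    ((volume : Measure (ℝ × ℝ)).restrict (X ×ˢ X))

/-- `T` is the integral operator on `L²(X, ℂ^k)` with kernel `K`: for every `φ`,
`(T φ)(x) = ∫_X K(x, y) φ(y) dy` for almost every `x ∈ X`. -/
def HasKernel {X : Set ℝ} {k : ℕ} (T : L2 X k →L[ℂ] L2 X k)
    (K : ℝ → ℝ → Matrix (Fin k) (Fin k) ℂ) : Prop :=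
  ∀ φ : L2 X k, ∀ᵐ x ∂((volume : Measure ℝ).restrict X),
    T φ x = ∫ y in X, Matrix.toEuclideanLin (K x y) (φ y)

end TraceFormula

end

/-! Let `e` be an orthonormal basis of eigenvectors of `T* T`. The norms `‖T (e i)‖` are the
singular values, so they are summable; giving each factor of `⟪e i, ·⟫ T (e i)` the square root of
the norm writes `T = ∑ ⟪v i, ·⟫ u i` with `u`, `v` square-summable. Parseval and Fubini then give `∑
⟪v i, u i⟫` as the trace in every basis.

It remains to show `∑ ⟪v i x, u i x⟫ = Tr K(x, x)` almost everywhere and to integrate termwise. The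
diagonal is a null set, so almost everywhere equality of kernels is not enough. Instead, testing `T`
on indicators of a small interval around `x` gives the identity for averages
(`hasSum_inner_setIntegral`, `inner_indicatorVec_apply`). As the interval shrinks, continuity
handles `K`, Lebesgue differentiation handles each `u i`, `v i`, and the series is dominated by the
averages of `‖v i‖² + ‖u i‖²`, whose sum also converges by differentiation
(`hasSum_of_tendsto_of_norm_le`). -/

noncomputable section

namespace TraceFormula

universe u

/-! ### Singular vectors and rank-one expansions -/

section Abstract

variable {H : Type u} [NormedAddCommGroup H] [InnerProductSpace ℂ H] [CompleteSpace H]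

open ContinuousLinearMap in
/-- The eigenspaces of `T* T` for the eigenvalues `μ ^ 2`, `μ ≥ 0`. -/
abbrev singularSpace (T : H →L[ℂ] H) (μ : ℝ≥0) : Submodule ℂ H :=
  Module.End.eigenspace ((adjoint T ∘L T : H →L[ℂ] H) : H →ₗ[ℂ] H) (((μ : ℝ) : ℂ) ^ 2)

theorem singularMultiplicity_eq_finrank (T : H →L[ℂ] H) (μ : ℝ≥0) :
    singularMultiplicity T μ = Module.finrank ℂ (singularSpace T μ) := rfl

theorem isSymmetric_adjoint_comp_self (T : H →L[ℂ] H) :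
    ((ContinuousLinearMap.adjoint T ∘L T : H →L[ℂ] H) : H →ₗ[ℂ] H).IsSymmetric := by
  intro x y
  simp [ContinuousLinearMap.adjoint_inner_left, ContinuousLinearMap.adjoint_inner_right]

theorem isCompactOperator_adjoint_comp_self {T : H →L[ℂ] H} (hT : IsCompactOperator T) :
    IsCompactOperator ((ContinuousLinearMap.adjoint T ∘L T : H →L[ℂ] H) : H →ₗ[ℂ] H) :=
  hT.clm_comp (ContinuousLinearMap.adjoint T)

theorem mul_norm_sq_eq_of_mem_eigenspace {T : H →L[ℂ] H} {c : ℂ} {x : H}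
    (hx : x ∈ Module.End.eigenspace
      ((ContinuousLinearMap.adjoint T ∘L T : H →L[ℂ] H) : H →ₗ[ℂ] H) c) :
    c * (‖x‖ : ℂ) ^ 2 = (‖T x‖ : ℂ) ^ 2 := by
  have h : ContinuousLinearMap.adjoint T (T x) = c • x := Module.End.mem_eigenspace_iff.1 hx
  have h2 : inner ℂ x (ContinuousLinearMap.adjoint T (T x)) = inner ℂ (T x) (T x) :=
    ContinuousLinearMap.adjoint_inner_right _ _ _
  rw [h, inner_smul_right, inner_self_eq_norm_sq_to_K, inner_self_eq_norm_sq_to_K] at h2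
  exact h2

theorem norm_apply_eq_of_mem_singularSpace {T : H →L[ℂ] H} {μ : ℝ≥0} {x : H}
    (hx : x ∈ singularSpace T μ) : ‖T x‖ = μ * ‖x‖ := by
  have h := mul_norm_sq_eq_of_mem_eigenspace hx
  have h' : (μ * ‖x‖ : ℝ) ^ 2 = ‖T x‖ ^ 2 := by
    rw [mul_pow]; exact_mod_cast h
  exact ((pow_left_inj₀ (by positivity) (by positivity) two_ne_zero).1 h').symm

theorem orthogonalFamily_singularSpace (T : H →L[ℂ] H) :
    OrthogonalFamily ℂ (fun μ => singularSpace T μ) fun μ => (singularSpace T μ).subtypeₗᵢ := by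
  refine (isSymmetric_adjoint_comp_self T).orthogonalFamily_eigenspaces.comp
    (γ := ℝ≥0) (f := fun μ : ℝ≥0 => ((μ : ℝ) : ℂ) ^ 2) fun μ ν h => ?_
  have h' : (μ : ℝ) ^ 2 = (ν : ℝ) ^ 2 := by
    have h : ((μ : ℝ) : ℂ) ^ 2 = ((ν : ℝ) : ℂ) ^ 2 := h
    rw [← Complex.ofReal_pow, ← Complex.ofReal_pow] at h
    exact Complex.ofReal_injective h
  exact NNReal.coe_injective ((pow_left_inj₀ (by positivity) (by positivity) two_ne_zero).1 h')

/-- An eigenvector `x` of `T* T` has eigenvalue `(‖T x‖ / ‖x‖)²`, so the spaces for `μ ≥ 0` exhaust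
the eigenspaces in the spectral theorem. -/
theorem orthogonal_iSup_singularSpace {T : H →L[ℂ] H} (hT : IsCompactOperator T) :
    (⨆ μ, singularSpace T μ)ᗮ = ⊥ := by
  rw [eq_bot_iff, ← ContinuousLinearMap.orthogonalComplement_iSup_eigenspaces_eq_bot
    (isCompactOperator_adjoint_comp_self hT) (isSymmetric_adjoint_comp_self T)]
  refine Submodule.orthogonal_le (iSup_le fun c => ?_)
  by_cases hc : Module.End.eigenspace
      ((ContinuousLinearMap.adjoint T ∘L T : H →L[ℂ] H) : H →ₗ[ℂ] H) c = ⊥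
  · rw [hc]; exact bot_le
  · obtain ⟨x, hx, hx0⟩ := Submodule.exists_mem_ne_zero_of_ne_bot hc
    have h := mul_norm_sq_eq_of_mem_eigenspace hx
    have hx' : (‖x‖ : ℂ) ≠ 0 := by simpa using hx0
    have hc' : c = (((‖T x‖₊ / ‖x‖₊ : ℝ≥0) : ℝ) : ℂ) ^ 2 := by
      push_cast
      field_simp
      exact h
    rw [hc']
    exact le_iSup (singularSpace T) (‖T x‖₊ / ‖x‖₊)

/-- A compact operator has an orthonormal basis of right singular vectors. -/
theorem exists_singularBasis {T : H →L[ℂ] H} (hT : IsCompactOperator T) :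
    ∃ (w : ∀ μ : ℝ≥0, Set (singularSpace T μ)) (b : ∀ μ, HilbertBasis (w μ) ℂ (singularSpace T μ))
      (e : HilbertBasis (Σ μ, w μ) ℂ H), ∀ i, e i = b i.1 i.2 := by
  have hcpl : ∀ μ, CompleteSpace (singularSpace T μ) := fun μ =>
    (ContinuousLinearMap.isClosed_eigenspace
      (ContinuousLinearMap.adjoint T ∘L T) _).completeSpace_coe
  choose w b _ using fun μ => exists_hilbertBasis ℂ (singularSpace T μ)
  have hon : Orthonormal ℂ fun i : Σ μ, w μ => ((b i.1 i.2 : singularSpace T i.1) : H) :=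
    (orthogonalFamily_singularSpace T).orthonormal_sigma_orthonormal fun μ => (b μ).orthonormal
  have hbot : (Submodule.span ℂ (Set.range fun i : Σ μ, w μ =>
      ((b i.1 i.2 : singularSpace T i.1) : H)))ᗮ = ⊥ := by
    rw [eq_bot_iff, ← orthogonal_iSup_singularSpace hT]
    intro x hx
    rw [← Submodule.iInf_orthogonal, Submodule.mem_iInf]
    intro μ y hy
    have hs := ((b μ).hasSum_repr ⟨y, hy⟩).mapL (singularSpace T μ).subtypeL
    have hs' := (hs.mapL (innerSL ℂ x))
    have : inner ℂ x y = 0 := by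
      refine hs'.unique ?_
      convert hasSum_zero with j
      have : inner ℂ ((b μ j : singularSpace T μ) : H) x = 0 :=
        hx _ (Submodule.subset_span ⟨⟨μ, j⟩, rfl⟩)
      simp [inner_eq_zero_symm.1 this]
    exact inner_eq_zero_symm.1 this
  exact ⟨w, b, HilbertBasis.mkOfOrthogonalEqBot hon hbot, fun i => by simp⟩

theorem exists_summable_norm_apply {T : H →L[ℂ] H} (hT : IsTraceClass T) :
    ∃ (ι : Type u) (e : HilbertBasis ι ℂ H), Summable fun i => ‖T (e i)‖ := by
  obtain ⟨w, b, e, he⟩ := exists_singularBasis hT.1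
  refine ⟨_, e, ?_⟩
  have hnorm : ∀ i, ‖T (e i)‖₊ = i.1 := fun i => by
    have h := norm_apply_eq_of_mem_singularSpace (b i.1 i.2).2
    have h1 : ‖((b i.1 i.2 : singularSpace T i.1) : H)‖ = 1 := (b i.1).orthonormal.1 i.2
    rw [h1, mul_one] at h
    rw [he]
    exact NNReal.coe_injective h
  have hcard : ∀ μ : ℝ≥0, ∑' _ : w μ, (μ : ℝ≥0∞) = singularMultiplicity T μ * (μ : ℝ≥0∞) := by
    intro μ
    -- The kernel may be infinite dimensional, where `finrank` is `0`; the factor `μ = 0` makes this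
    -- harmless.
    rcases eq_or_ne μ 0 with rfl | hμ
    · simp
    have : FiniteDimensional ℂ (singularSpace T μ) :=
      ContinuousLinearMap.finite_dimensional_eigenspace
        (isCompactOperator_adjoint_comp_self hT.1) _ (by simpa using hμ)
    have : Finite (w μ) := (b μ).orthonormal.linearIndependent.finite
    have := Fintype.ofFinite (w μ)
    rw [singularMultiplicity_eq_finrank,
      Module.finrank_eq_card_basis (b μ).toOrthonormalBasis.toBasis]
    simp
  have hsum : ∑' i, (‖T (e i)‖₊ : ℝ≥0∞) = traceNorm T := by
    simp_rw [hnorm, traceNorm, ← hcard]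
    exact ENNReal.tsum_sigma' _
  have : Summable fun i => ‖T (e i)‖₊ := ENNReal.tsum_coe_ne_top_iff_summable.1
    (hsum ▸ hT.2.ne)
  exact NNReal.summable_coe.2 this

/-- A trace class operator is a countable sum of operators of rank one `φ ↦ ⟪v i, φ⟫ u i`, with
`u` and `v` square-summable. -/
theorem exists_hasSum_rankOne {T : H →L[ℂ] H} (hT : IsTraceClass T) :
    ∃ (ι : Type u) (u v : ι → H), Countable ι ∧ (Summable fun i => ‖u i‖ ^ 2) ∧
      (Summable fun i => ‖v i‖ ^ 2) ∧ ∀ φ, HasSum (fun i => inner ℂ (v i) φ • u i) (T φ) := by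
  obtain ⟨κ, e, he⟩ := exists_summable_norm_apply hT
  -- Dropping the basis vectors killed by `T` makes the index set countable and the square roots
  -- invertible.
  let s : Set κ := Function.support fun i => ‖T (e i)‖
  have hpos : ∀ i : s, 0 < √‖T (e i)‖ := fun i =>
    Real.sqrt_pos.2 ((norm_nonneg _).lt_of_ne' i.2)
  have hs : Summable fun i : s => ‖T (e i)‖ := he.subtype s
  refine ⟨s, fun i => ((√‖T (e i)‖ : ℝ) : ℂ)⁻¹ • T (e i), fun i => ((√‖T (e i)‖ : ℝ) : ℂ) • e i,
    he.countable_support.to_subtype, hs.congr fun i => ?_, hs.congr fun i => ?_, fun φ => ?_⟩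
  · have h := hpos i
    have h2 := Real.sq_sqrt (norm_nonneg (T (e i)))
    rw [norm_smul, mul_pow, norm_inv, Complex.norm_real, Real.norm_of_nonneg h.le, inv_pow, h2]
    have h3 : ‖T (e i)‖ ≠ 0 := i.2
    field_simp
  · rw [norm_smul, mul_pow, Complex.norm_real, Real.norm_of_nonneg (hpos i).le,
      Real.sq_sqrt (norm_nonneg _), e.orthonormal.1]
    simp
  · have h := (e.hasSum_repr φ).mapL T
    rw [← hasSum_subtype_iff_of_support_subset (s := s)] at h
    · refine h.congr_fun fun i => ?_
      have h0 : ((√‖T (e i)‖ : ℝ) : ℂ) ≠ 0 := by exact_mod_cast (hpos i).ne'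
      simp only [Function.comp_apply, map_smul, inner_smul_left, smul_smul, Complex.conj_ofReal,
        e.repr_apply_apply]
      congr 1
      field_simp
    · intro i hi
      contrapose! hi
      have : T (e i) = 0 := by simpa [s] using hi
      simp [this]

/-! ### Independence of the trace from the basis -/

theorem hasSum_norm_inner_sq {κ E : Type*} [NormedAddCommGroup E] [InnerProductSpace ℂ E]
    (h : HilbertBasis κ ℂ E) (x : E) :
    HasSum (fun j => ‖inner ℂ (h j) x‖ ^ 2) (‖x‖ ^ 2) := by
  have := h.hasSum_inner_mul_inner x x
  rw [inner_self_eq_norm_sq_to_K] at this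
  refine Complex.hasSum_ofReal.1 ?_
  push_cast
  refine this.congr_fun fun j => ?_
  rw [← inner_conj_symm x (h j), Complex.conj_mul']

end Abstract

theorem hasTrace_of_hasSum_rankOne {H : Type u} [NormedAddCommGroup H]
    [InnerProductSpace ℂ H] {T : H →L[ℂ] H} {ι : Type*} {u v : ι → H}
    (hu : Summable fun i => ‖u i‖ ^ 2) (hv : Summable fun i => ‖v i‖ ^ 2)
    (hT : ∀ φ, HasSum (fun i => inner ℂ (v i) φ • u i) (T φ)) :
    HasTrace T (∑' i, inner ℂ (v i) (u i)) := by
  intro κ h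
  have hsq : ∀ {f : ι → H}, (Summable fun i => ‖f i‖ ^ 2) →
      Summable fun p : ι × κ => ‖inner ℂ (h p.2) (f p.1)‖ ^ 2 := fun {f} hf => by
    rw [summable_prod_of_nonneg fun _ => by positivity]
    exact ⟨fun i => (hasSum_norm_inner_sq h (f i)).summable,
      hf.congr fun i => (hasSum_norm_inner_sq h (f i)).tsum_eq.symm⟩
  have hsum : Summable fun p : ι × κ => inner ℂ (v p.1) (h p.2) * inner ℂ (h p.2) (u p.1) := by
    refine ((hsq hu).add (hsq hv)).of_norm_bounded fun p => ?_
    rw [norm_mul, norm_inner_symm (v p.1)]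
    nlinarith [sq_nonneg (‖inner ℂ (h p.2) (u p.1)‖ - ‖inner ℂ (h p.2) (v p.1)‖),
      sq_nonneg ‖inner ℂ (h p.2) (u p.1)‖, sq_nonneg ‖inner ℂ (h p.2) (v p.1)‖]
  have h1 := hsum.hasSum.prod_fiberwise fun i => h.hasSum_inner_mul_inner (v i) (u i)
  rw [h1.tsum_eq]
  refine ((Equiv.prodComm κ ι).hasSum_iff.2 hsum.hasSum).prod_fiberwise fun j => ?_
  have := (hT (h j)).mapL (innerSL ℂ (h j))
  simpa [inner_smul_right] using this

/-! ### Limits of series and of averages -/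

open Filter Topology Metric

/-- Dominated convergence for series, with bounds that converge together with their sums. -/
theorem hasSum_of_tendsto_of_norm_le {ι α E : Type*} [NormedAddCommGroup E] {l : Filter α}
    [l.NeBot] {g : α → ι → E} {g₀ : ι → E} {b : α → ι → ℝ} {b₀ : ι → ℝ} {G : α → E} {G₀ : E}
    {B : α → ℝ} {B₀ : ℝ} (hg : ∀ i, Tendsto (fun a => g a i) l (𝓝 (g₀ i)))
    (hb : ∀ i, Tendsto (fun a => b a i) l (𝓝 (b₀ i))) (hG : Tendsto G l (𝓝 G₀))
    (hB : Tendsto B l (𝓝 B₀)) (hgb : ∀ᶠ a in l, ∀ i, ‖g a i‖ ≤ b a i)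
    (hgs : ∀ᶠ a in l, HasSum (g a) (G a)) (hbs : ∀ᶠ a in l, HasSum (b a) (B a))
    (hb₀ : HasSum b₀ B₀) : HasSum g₀ G₀ := by
  -- For each `a`, the tail of `g a` outside `s` is bounded by the tail of `b a`; this passes to the
  -- limit with `s` fixed.
  have key : ∀ s : Finset ι, ‖∑ i ∈ s, g₀ i - G₀‖ ≤ B₀ - ∑ i ∈ s, b₀ i := by
    intro s
    rw [norm_sub_rev]
    refine le_of_tendsto_of_tendsto (hG.sub (tendsto_finsetSum s fun i _ => hg i)).norm
      (hB.sub (tendsto_finsetSum s fun i _ => hb i)) ?_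
    filter_upwards [hgb, hgs, hbs] with a h1 h2 h3
    exact (s.hasSum_iff_compl.1 h2).norm_le_of_bounded (s.hasSum_iff_compl.1 h3) fun i => h1 i
  refine tendsto_iff_norm_sub_tendsto_zero.2
    (squeeze_zero (fun _ => norm_nonneg _) key ?_)
  simpa using (tendsto_const_nhds (x := B₀)).sub hb₀

/-- Beppo Levi's theorem for series of integrable functions. -/
theorem exists_integrable_hasSum {α ι : Type*} [MeasurableSpace α] {μ : Measure α} [Countable ι]
    {F : ι → α → ℝ} (h0 : ∀ i a, 0 ≤ F i a) (hF : ∀ i, Integrable (F i) μ)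
    (hs : Summable fun i => ∫ a, F i a ∂μ) :
    ∃ S : α → ℝ, Integrable S μ ∧ ∀ᵐ a ∂μ, HasSum (fun i => F i a) (S a) := by
  have hm : ∀ i, AEMeasurable (fun a => ENNReal.ofReal (F i a)) μ := fun i =>
    (hF i).1.aemeasurable.ennreal_ofReal
  have hfin : ∫⁻ a, ∑' i, ENNReal.ofReal (F i a) ∂μ ≠ ∞ := by
    rw [lintegral_tsum hm]
    simp_rw [← ofReal_integral_eq_lintegral_ofReal (hF _) (ae_of_all _ (h0 _))]
    rw [← ENNReal.ofReal_tsum_of_nonneg (fun i => integral_nonneg (h0 i)) hs]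
    exact ENNReal.ofReal_ne_top
  have hmt : AEMeasurable (fun a => ∑' i, ENNReal.ofReal (F i a)) μ := .tsum hm
  refine ⟨_, integrable_toReal_of_lintegral_ne_top hmt hfin, ?_⟩
  filter_upwards [ae_lt_top' hmt hfin] with a ha
  have h := ENNReal.hasSum_toReal ha.ne
  rw [← ENNReal.tsum_toReal_eq fun _ => ENNReal.ofReal_ne_top] at h
  simpa only [ENNReal.toReal_ofReal (h0 _ _)] using h

theorem hasSum_integral_of_ae_hasSum {α ι : Type*} [MeasurableSpace α] {μ : Measure α}
    [Countable ι] {E : Type*} [NormedAddCommGroup E] [NormedSpace ℝ E] {F : ι → α → E}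
    {S : α → E} (hF : ∀ i, Integrable (F i) μ) (hs : Summable fun i => ∫ a, ‖F i a‖ ∂μ)
    (hS : ∀ᵐ a ∂μ, HasSum (fun i => F i a) (S a)) :
    HasSum (fun i => ∫ a, F i a ∂μ) (∫ a, S a ∂μ) := by
  convert hasSum_integral_of_summable_integral_norm hF hs using 1
  exact integral_congr_ae (hS.mono fun a ha => ha.tsum_eq.symm)

theorem eventually_closedBall_subset {X : Set ℝ} {x : ℝ} (hx : x ∈ interior X) :
    ∀ᶠ δ in 𝓝[>] (0 : ℝ), closedBall x δ ⊆ X :=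
  nhdsWithin_le_nhds (_root_.eventually_closedBall_subset (mem_interior_iff_mem_nhds.1 hx))

/-- Lebesgue's differentiation theorem at the interior points of a set. -/
theorem ae_tendsto_average_of_locallyIntegrable_indicator {E : Type*} [NormedAddCommGroup E]
    [NormedSpace ℝ E] [CompleteSpace E] {X : Set ℝ} {g : ℝ → E}
    (hg : LocallyIntegrable (X.indicator g)) :
    ∀ᵐ x, x ∈ interior X →
      Tendsto (fun δ => ⨍ s in closedBall x δ, g s) (𝓝[>] 0) (𝓝 (g x)) := by
  filter_upwards [IsUnifLocDoublingMeasure.ae_tendsto_average volume hg 1] with x hx hxX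
  have h := hx (fun _ => x) id tendsto_id (by
    filter_upwards [self_mem_nhdsWithin] with δ hδ
    have : (0 : ℝ) < δ := hδ
    simp [this.le])
  rw [Set.indicator_of_mem (interior_subset hxX)] at h
  refine h.congr' ?_
  filter_upwards [eventually_closedBall_subset hxX] with δ hδ
  exact setAverage_congr_fun measurableSet_closedBall
    (ae_of_all _ fun s hs => Set.indicator_of_mem (hδ hs) _)

/-- Near `(x, x)` the values lie in a small closed ball about `f x x`; it is closed and convex,
hence contains both successive averages. -/
theorem tendsto_average_average {E : Type*} [NormedAddCommGroup E]
    [NormedSpace ℝ E] [CompleteSpace E] {X : Set ℝ} {f : ℝ → ℝ → E}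
    (hf : ContinuousOn (fun p : ℝ × ℝ => f p.1 p.2) (X ×ˢ X)) {x : ℝ} (hx : x ∈ interior X) :
    Tendsto (fun δ => ⨍ s in closedBall x δ, ⨍ y in closedBall x δ, f s y) (𝓝[>] 0)
      (𝓝 (f x x)) := by
  have hX := mem_interior_iff_mem_nhds.1 hx
  have hc : ContinuousAt (fun p : ℝ × ℝ => f p.1 p.2) (x, x) :=
    hf.continuousAt (prod_mem_nhds hX hX)
  rw [(nhds_basis_closedBall (x := f x x)).tendsto_right_iff]
  intro ε hε
  have h1 : ∀ᶠ δ in 𝓝[>] (0 : ℝ), closedBall (x, x) δ ⊆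
      (fun p : ℝ × ℝ => f p.1 p.2) ⁻¹' closedBall (f x x) ε :=
    nhdsWithin_le_nhds (_root_.eventually_closedBall_subset (hc (closedBall_mem_nhds _ hε)))
  filter_upwards [h1, eventually_closedBall_subset hx, self_mem_nhdsWithin] with δ h2 h3 hδ
  have hδ : (0 : ℝ) < δ := hδ
  rw [← closedBall_prod_same] at h2
  have hv0 : (volume : Measure ℝ) (closedBall x δ) ≠ 0 := by simp [Real.volume_closedBall, hδ]
  have hvt : (volume : Measure ℝ) (closedBall x δ) ≠ ∞ := measure_closedBall_lt_top.ne
  have hK : IsCompact (closedBall x δ) := isCompact_closedBall x δ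
  have hfK : ContinuousOn (fun p : ℝ × ℝ => f p.1 p.2) (closedBall x δ ×ˢ closedBall x δ) :=
    hf.mono (Set.prod_mono h3 h3)
  have hint : IntegrableOn (fun p : ℝ × ℝ => f p.1 p.2) (closedBall x δ ×ˢ closedBall x δ)
      (volume.prod volume) := hfK.integrableOn_compact (hK.prod hK)
  have hint' : IntegrableOn (fun s => ∫ y in closedBall x δ, f s y) (closedBall x δ) := by
    rw [IntegrableOn, ← Measure.prod_restrict] at hint
    exact hint.integral_prod_left
  refine (convex_closedBall _ _).set_average_mem isClosed_closedBall hv0 hvt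
    ((ae_restrict_iff' measurableSet_closedBall).2 (ae_of_all _ fun s hs => ?_)) ?_
  · refine (convex_closedBall _ _).set_average_mem isClosed_closedBall hv0 hvt
      ((ae_restrict_iff' measurableSet_closedBall).2 (ae_of_all _ fun y hy =>
        Set.mem_preimage.1 (h2 (Set.mk_mem_prod hs hy)))) ?_
    exact (hfK.comp (f := fun y => (s, y)) (by fun_prop)
      fun y hy => ⟨hs, hy⟩).integrableOn_compact hK
  · simp_rw [setAverage_eq]
    exact hint'.smul _

/-- Jensen's inequality for the convex function `‖·‖²`. -/
theorem norm_average_sq_le {α E : Type*} [MeasurableSpace α] {μ : Measure α}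
    [NormedAddCommGroup E] [NormedSpace ℝ E] [CompleteSpace E] {s : Set α} {f : α → E}
    (h0 : μ s ≠ 0) (ht : μ s ≠ ∞) (hf : MemLp f 2 (μ.restrict s)) :
    ‖⨍ x in s, f x ∂μ‖ ^ 2 ≤ ⨍ x in s, ‖f x‖ ^ 2 ∂μ := by
  have : IsFiniteMeasure (μ.restrict s) := ⟨by simpa using ht.lt_top⟩
  exact (convexOn_univ_norm.pow (fun _ _ => norm_nonneg _) 2).map_set_average_le
    (by fun_prop) isClosed_univ h0 ht (by simp) (hf.integrable one_le_two)
    ((memLp_two_iff_integrable_sq_norm hf.1).1 hf)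

/-! ### Integral operators on `L²(X, ℂ^k)` and the diagonal of the kernel -/

variable {X : Set ℝ} {k : ℕ}

theorem restrict_restrict_of_subset {B : Set ℝ} (hB : MeasurableSet B) (hBX : B ⊆ X) :
    ((volume : Measure ℝ).restrict X).restrict B = volume.restrict B := by
  rw [Measure.restrict_restrict hB, Set.inter_eq_left.2 hBX]

theorem restrict_ne_top {B : Set ℝ} (hB : volume B ≠ ∞) :
    (volume : Measure ℝ).restrict X B ≠ ∞ :=
  ((Measure.restrict_apply_le _ _).trans_lt hB.lt_top).ne

/-- The class in `L²(X, ℂ^k)` of the indicator function of `B` times the `c`-th unit vector. -/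
def indicatorVec (X : Set ℝ) {k : ℕ} {B : Set ℝ} (hB : MeasurableSet B) (hBt : volume B ≠ ∞)
    (c : Fin k) : L2 X k :=
  indicatorConstLp 2 hB (restrict_ne_top hBt) (EuclideanSpace.single c (1 : ℂ))

theorem inner_indicatorVec {B : Set ℝ} (hB : MeasurableSet B) (hBt : volume B ≠ ∞)
    (hBX : B ⊆ X) (c : Fin k) (f : L2 X k) :
    inner ℂ (indicatorVec X hB hBt c) f = (∫ s in B, f s) c := by
  rw [indicatorVec, L2.inner_indicatorConstLp_eq_inner_setIntegral,
    restrict_restrict_of_subset hB hBX, EuclideanSpace.inner_single_left]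
  simp

theorem hasSum_inner_setIntegral {T : L2 X k →L[ℂ] L2 X k} {ι : Type*} {u v : ι → L2 X k}
    (hT : ∀ φ, HasSum (fun i => inner ℂ (v i) φ • u i) (T φ)) {B : Set ℝ}
    (hB : MeasurableSet B) (hBt : volume B ≠ ∞) (hBX : B ⊆ X) :
    HasSum (fun i => inner ℂ (∫ s in B, v i s) (∫ s in B, u i s))
      (∑ c, inner ℂ (indicatorVec X hB hBt c) (T (indicatorVec X hB hBt c))) := by
  have h : ∀ c : Fin k, HasSum (fun i => inner ℂ ((∫ s in B, v i s) c) ((∫ s in B, u i s) c))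
      (inner ℂ (indicatorVec X hB hBt c) (T (indicatorVec X hB hBt c))) := fun c => by
    refine ((hT _).mapL (innerSL ℂ (indicatorVec X hB hBt c))).congr_fun fun i => ?_
    rw [innerSL_apply_apply, inner_smul_right, ← inner_conj_symm (v i), inner_indicatorVec hB hBt hBX,
      inner_indicatorVec hB hBt hBX, RCLike.inner_apply, mul_comm]
  simpa only [PiLp.inner_apply] using hasSum_sum fun c _ => h c

theorem inner_indicatorVec_apply {T : L2 X k →L[ℂ] L2 X k}
    {K : ℝ → ℝ → Matrix (Fin k) (Fin k) ℂ} (hTK : HasKernel T K)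
    (hcont : ContinuousOn (fun p : ℝ × ℝ => K p.1 p.2) (X ×ˢ X)) {B : Set ℝ}
    (hB : IsCompact B) (hBX : B ⊆ X) (c : Fin k) :
    inner ℂ (indicatorVec X hB.measurableSet hB.measure_ne_top c)
      (T (indicatorVec X hB.measurableSet hB.measure_ne_top c)) =
      ∫ s in B, ∫ y in B, K s y c c := by
  set φ := indicatorVec X hB.measurableSet hB.measure_ne_top c with hφ
  have hφy : ∀ᵐ y ∂(volume : Measure ℝ).restrict X,
      φ y = B.indicator (fun _ => EuclideanSpace.single c (1 : ℂ)) y := indicatorConstLp_coeFn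
  have hTφ := hTK φ
  refine (L2.inner_indicatorConstLp_eq_setIntegral_inner ℂ (T φ) hB.measurableSet _ _).trans ?_
  rw [restrict_restrict_of_subset hB.measurableSet hBX]
  refine setIntegral_congr_ae hB.measurableSet ?_
  have hTφ' := ae_restrict_of_ae_restrict_of_subset hBX hTφ
  rw [ae_restrict_iff' hB.measurableSet] at hTφ'
  filter_upwards [hTφ'] with s hs hsB
  have h1 : (∫ y in X, Matrix.toEuclideanLin (K s y) (φ y)) =
      ∫ y in B, Matrix.toEuclideanLin (K s y) (EuclideanSpace.single c (1 : ℂ)) := by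
    rw [← restrict_restrict_of_subset hB.measurableSet hBX, ← integral_indicator hB.measurableSet]
    refine integral_congr_ae ?_
    filter_upwards [hφy] with y hy
    rw [hy]
    by_cases hyB : y ∈ B <;> simp [hyB]
  have hK : ContinuousOn (fun y => K s y) B :=
    hcont.comp (f := fun y => (s, y)) (by fun_prop) fun y hy => ⟨hBX hsB, hBX hy⟩
  have hL : Continuous fun M : Matrix (Fin k) (Fin k) ℂ =>
      Matrix.toEuclideanLin M (EuclideanSpace.single c (1 : ℂ)) :=
    LinearMap.continuous_of_finiteDimensional
      ((LinearMap.applyₗ (EuclideanSpace.single c (1 : ℂ))).comp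
        (Matrix.toEuclideanLin (𝕜 := ℂ) (m := Fin k) (n := Fin k)).toLinearMap)
  have hint : IntegrableOn (fun y => Matrix.toEuclideanLin (K s y)
      (EuclideanSpace.single c (1 : ℂ))) B :=
    (hL.comp_continuousOn hK).integrableOn_compact hB
  rw [hs hsB, h1, ← integral_inner hint]
  refine integral_congr_ae (ae_of_all _ fun y => ?_)
  simp [EuclideanSpace.inner_single_left, Matrix.toLpLin_apply]

theorem memLp_coeFn (f : L2 X k) : MemLp f 2 ((volume : Measure ℝ).restrict X) := Lp.memLp f

theorem integral_norm_sq (f : L2 X k) : ∫ s in X, ‖f s‖ ^ 2 = ‖f‖ ^ 2 := by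
  have h : inner ℂ f f = ((‖f‖ : ℂ)) ^ 2 := inner_self_eq_norm_sq_to_K f
  rw [L2.inner_def] at h
  simp_rw [inner_self_eq_norm_sq_to_K] at h
  have h2 : (∫ s in X, ((‖f s‖ ^ 2 : ℝ) : ℂ)) = ((‖f‖ ^ 2 : ℝ) : ℂ) := by
    push_cast
    exact h
  rw [integral_complex_ofReal] at h2
  exact_mod_cast h2

theorem integrable_norm_sq (f : L2 X k) :
    Integrable (fun s => ‖f s‖ ^ 2) ((volume : Measure ℝ).restrict X) :=
  (memLp_two_iff_integrable_sq_norm (memLp_coeFn f).1).1 (memLp_coeFn f)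

/-- On the diagonal, the trace of the kernel of `∑ u i ⊗ v i` is `∑ ⟪v i x, u i x⟫` almost
everywhere. -/
theorem ae_hasSum_inner_trace {T : L2 X k →L[ℂ] L2 X k} (hX : MeasurableSet X)
    {K : ℝ → ℝ → Matrix (Fin k) (Fin k) ℂ} (hTK : HasKernel T K)
    (hcont : ContinuousOn (fun p : ℝ × ℝ => K p.1 p.2) (X ×ˢ X))
    {ι : Type*} [Countable ι] {u v : ι → L2 X k}
    (hu : Summable fun i => ‖u i‖ ^ 2) (hv : Summable fun i => ‖v i‖ ^ 2)
    (hT : ∀ φ, HasSum (fun i => inner ℂ (v i) φ • u i) (T φ)) :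
    ∀ᵐ x, x ∈ interior X → HasSum (fun i => inner ℂ (v i x) (u i x)) (K x x).trace := by
  -- The dominating functions, from `‖⟪v, u⟫‖ ≤ ‖v‖² + ‖u‖²`.
  let b : ι → ℝ → ℝ := fun i s => ‖v i s‖ ^ 2 + ‖u i s‖ ^ 2
  have hb : ∀ i, Integrable (b i) (volume.restrict X) := fun i =>
    (integrable_norm_sq (v i)).add (integrable_norm_sq (u i))
  have hb0 : ∀ i s, 0 ≤ b i s := fun i s => by positivity
  have hbs : Summable fun i => ∫ s in X, b i s := by
    refine (hv.add hu).congr fun i => ?_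
    rw [integral_add (integrable_norm_sq (v i)) (integrable_norm_sq (u i)), integral_norm_sq,
      integral_norm_sq]
  obtain ⟨S, hS, hbS⟩ := exists_integrable_hasSum hb0 hb hbs
  have hloc : ∀ f : L2 X k, LocallyIntegrable (X.indicator f) := fun f =>
    ((memLp_indicator_iff_restrict hX).2 (memLp_coeFn f)).locallyIntegrable one_le_two
  have hloc' : ∀ {g : ℝ → ℝ}, Integrable g (volume.restrict X) →
      LocallyIntegrable (X.indicator g) := fun hg =>
    ((integrable_indicator_iff hX).2 hg).locallyIntegrable
  filter_upwards [ae_all_iff.2 fun i => ae_tendsto_average_of_locallyIntegrable_indicator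
      (hloc (u i)), ae_all_iff.2 fun i => ae_tendsto_average_of_locallyIntegrable_indicator
      (hloc (v i)), ae_all_iff.2 fun i => ae_tendsto_average_of_locallyIntegrable_indicator
      (hloc' (hb i)), ae_tendsto_average_of_locallyIntegrable_indicator (hloc' hS),
    (ae_restrict_iff' hX).1 hbS] with x hux hvx hbx hSx hbSx hx
  have hG : Tendsto (fun δ => ∑ c, ⨍ s in closedBall x δ, ⨍ y in closedBall x δ, K s y c c)
      (𝓝[>] 0) (𝓝 (K x x).trace) := by
    refine tendsto_finsetSum _ fun c _ => tendsto_average_average (X := X)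
      (f := fun s y => K s y c c) ?_ hx
    exact (continuous_id.matrix_elem c c).comp_continuousOn hcont
  refine hasSum_of_tendsto_of_norm_le (fun i => (hvx i hx).inner (hux i hx))
    (fun i => hbx i hx) hG (hSx hx) ?_ ?_ ?_ (hbSx (interior_subset hx))
  all_goals
    filter_upwards [eventually_closedBall_subset hx, self_mem_nhdsWithin] with δ hBX hδ
    have hδ : (0 : ℝ) < δ := hδ
    have hv0 : (volume : Measure ℝ) (closedBall x δ) ≠ 0 := by simp [Real.volume_closedBall, hδ]
    have hvt : (volume : Measure ℝ) (closedBall x δ) ≠ ∞ := measure_closedBall_lt_top.ne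
    have hle : (volume : Measure ℝ).restrict (closedBall x δ) ≤ volume.restrict X :=
      Measure.restrict_mono hBX le_rfl
  · intro i
    have h1 := norm_average_sq_le hv0 hvt ((memLp_coeFn (v i)).mono_measure hle)
    have h2 := norm_average_sq_le hv0 hvt ((memLp_coeFn (u i)).mono_measure hle)
    have h3 : ⨍ s in closedBall x δ, b i s = (⨍ s in closedBall x δ, ‖v i s‖ ^ 2) +
        ⨍ s in closedBall x δ, ‖u i s‖ ^ 2 := by
      simp only [b, setAverage_eq]
      rw [integral_add ((integrable_norm_sq (v i)).mono_measure hle)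
        ((integrable_norm_sq (u i)).mono_measure hle), smul_add]
    rw [h3]
    refine (norm_inner_le_norm _ _).trans ?_
    nlinarith [sq_nonneg (‖⨍ s in closedBall x δ, v i s‖ - ‖⨍ s in closedBall x δ, u i s‖),
      sq_nonneg ‖⨍ s in closedBall x δ, v i s‖, sq_nonneg ‖⨍ s in closedBall x δ, u i s‖]
  · have hB := isCompact_closedBall x δ
    have h := hasSum_inner_setIntegral hT hB.measurableSet hB.measure_ne_top hBX
    simp_rw [inner_indicatorVec_apply hTK hcont hB hBX] at h
    -- One factor `1 / |B|` for each of the two averages.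
    have h' := (h.const_smul (volume.real (closedBall x δ))⁻¹).const_smul
      (volume.real (closedBall x δ))⁻¹
    simp_rw [setAverage_eq, integral_smul, ← Finset.smul_sum]
    refine h'.congr_fun fun i => ?_
    rw [inner_smul_left_eq_smul, inner_smul_right_eq_smul]
  · simp_rw [setAverage_eq]
    refine HasSum.const_smul _ (hasSum_integral_of_ae_hasSum (fun i => (hb i).mono_measure hle)
      ?_ (ae_mono hle hbS))
    refine hbs.of_nonneg_of_le (fun i => integral_nonneg fun s => norm_nonneg _) fun i => ?_
    simp_rw [Real.norm_of_nonneg (hb0 i _)]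
    exact integral_mono_measure hle (ae_of_all _ (hb0 i)) (hb i)

theorem hasSum_inner_integral_trace {T : L2 X k →L[ℂ] L2 X k} (hX : MeasurableSet X)
    (hXi : volume (X \ interior X) = 0)
    {K : ℝ → ℝ → Matrix (Fin k) (Fin k) ℂ} (hTK : HasKernel T K)
    (hcont : ContinuousOn (fun p : ℝ × ℝ => K p.1 p.2) (X ×ˢ X))
    {ι : Type*} [Countable ι] {u v : ι → L2 X k}
    (hu : Summable fun i => ‖u i‖ ^ 2) (hv : Summable fun i => ‖v i‖ ^ 2)
    (hT : ∀ φ, HasSum (fun i => inner ℂ (v i) φ • u i) (T φ)) :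
    HasSum (fun i => inner ℂ (v i) (u i)) (∫ x in X, (K x x).trace) := by
  refine hasSum_integral_of_ae_hasSum (fun i => L2.integrable_inner (v i) (u i)) ?_ ?_
  · refine (hv.add hu).of_nonneg_of_le (fun i => integral_nonneg fun s => norm_nonneg _)
      fun i => ?_
    rw [← integral_norm_sq, ← integral_norm_sq,
      ← integral_add (integrable_norm_sq (v i)) (integrable_norm_sq (u i))]
    refine integral_mono (L2.integrable_inner (v i) (u i)).norm
      ((integrable_norm_sq (v i)).add (integrable_norm_sq (u i))) fun s => ?_
    refine (norm_inner_le_norm _ _).trans ?_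
    show ‖v i s‖ * ‖u i s‖ ≤ ‖v i s‖ ^ 2 + ‖u i s‖ ^ 2
    nlinarith [sq_nonneg (‖v i s‖ - ‖u i s‖), sq_nonneg ‖v i s‖, sq_nonneg ‖u i s‖]
  · rw [ae_restrict_iff' hX]
    filter_upwards [ae_hasSum_inner_trace hX hTK hcont hu hv hT, measure_eq_zero_iff_ae_notMem.1 hXi]
      with x hx hxi hxX
    -- Differentiation was only done at interior points; the rest of `X` is null.
    exact hx (by_contra fun h => hxi ⟨hxX, h⟩)

end TraceFormula
end

theorem mainTheorem6 (k : ℕ) (X : Set ℝ)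
    (hX : (∃ a b : ℝ, a ≤ b ∧ X = Set.Icc a b) ∨ X = Set.univ)
    (T : TraceFormula.L2 X k →L[ℂ] TraceFormula.L2 X k)
    (hT : TraceFormula.IsTraceClass T)
    (K : ℝ → ℝ → Matrix (Fin k) (Fin k) ℂ)
    (hTK : TraceFormula.HasKernel T K)
    (hK : TraceFormula.IsL2Kernel X K)
    (hcont : ContinuousOn (fun p : ℝ × ℝ => K p.1 p.2) (X ×ˢ X))
    (hF : IntegrableOn (fun x : ℝ => (K x x).trace) X) :
    TraceFormula.HasTrace T (TraceFormula.trace T) ∧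
      TraceFormula.trace T = ∫ x in X, (K x x).trace := by
  have hXm : MeasurableSet X := by
    rcases hX with ⟨a, b, _, rfl⟩ | rfl
    exacts [measurableSet_Icc, MeasurableSet.univ]
  have hXi : volume (X \ interior X) = 0 := by
    rcases hX with ⟨a, b, hab, rfl⟩ | rfl
    · rw [interior_Icc, Set.Icc_sdiff_Ioo_same hab]
      exact (Set.toFinite _).measure_zero _
    · simp
  obtain ⟨ι, u, v, _, hu, hv, huv⟩ := TraceFormula.exists_hasSum_rankOne hT
  have htr := TraceFormula.hasTrace_of_hasSum_rankOne hu hv huv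
  rw [(TraceFormula.hasSum_inner_integral_trace hXm hXi hTK hcont hu hv huv).tsum_eq] at htr
  rw [htr.trace_eq]
  exact ⟨htr, rfl⟩
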